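/- Work in the universe $V$ of sets (with choice). **Names.** A forcing notion $\mathbb P$ is a set with a reflexive transitive order and a top condition $1$; a $\mathbb P$-name is a set of pairs $\langle\dot y,p\rangle$ with $\dot y$ a $\mathbb P$-name and $p\in\mathbb P$. A permutation $\pi$ of $\mathbb P$ acts on names by $\pi\dot x=\{\langle\pi\dot y,\pi p\rangle:\langle\dot y,p\rangle\in\dot x\}$. For a group $\mathcal G\le\mathrm{Aut}(\mathbb P)$ and a family $\mathcal F$ of subgroups of $\mathcal G$, put $\mathrm{sym}(\dot x)=\{g\in\mathcal G: g\dot x=\dot x\}$. A name $\dot x$ is hereditarily symmetric, $\dot x\in\mathrm{HS}(\mathbb P,\mathcal G,\mathcal F)$, if $\mathrm{sym}(\dot x)\in\mathcal F$ and $\dot y\in\mathrm{HS}(\mathbb P,\mathcal G,\mathcal F)$ for all $\langle\dot y,p\rangle\in\dot x$. A normal filter of subgroups of $\mathcal G$ is a family that contains $\mathcal G$, is closed upwards and under binary intersections, and is closed under conjugation. It is $\omega_1$-complete if it is closed under countable intersections. The $\omega_1$-completion of a normal filter consists of all subgroups that contain a countable intersection of its members. **The iteration.** Let $\langle(\mathbb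 P_\alpha,\mathcal G_\alpha,\mathcal F_\alpha):\alpha\le\Theta\rangle$ be a countable-support symmetric iteration with $\mathbb P_\alpha$-names $\langle\dot{\mathbb Q}_\alpha,\dot{\mathcal H}_\alpha,\dot{\mathcal K}_\alpha\rangle$ ($\alpha<\Theta$) that $1_{\mathbb P_\alpha}$ forces to be symmetric systems. That is: - $\mathbb P_\alpha$ consists of the partial functions $p$ on $\alpha$ with countable domain such that for $\beta\in\mathrm{dom}(p)$ the value $p(\beta)$ is a $\mathbb P_\beta$-name (from a fixed set of names that represents all names for conditions of $\dot{\mathbb Q}_\beta$) and $p\restriction\beta\Vdash p(\beta)\in\dot{\mathbb Q}_\beta$; and $q\le p$ iff $\mathrm{dom}(q)\supseteq\mathrm{dom}(p)$ and $q\restriction\beta\Vdash q(\beta)\le p(\beta)$ for all $\beta\in\mathrm{dom}(p)$. - $\mathcal G_\alpha\le\mathrm{Aut}(\mathbb P_\alpha)$, and for $\beta\le\alpha$ there are coherent restriction homomorphisms $\rho_{\beta,\alpha}:\mathcal G_\alpha\to\mathcal G_\beta$ with $(gp)\restriction\beta=\rho_{\beta,\alpha}(g)(p\restriction\beta)$.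 - $\mathcal F_0=\{\mathcal G_0\}$. - $\mathcal G_{\alpha+1}$ is the two-step group of the automorphisms $(p,\dot q)\mapsto(\pi p,\pi(\dot\sigma(\dot q)))$ with $\pi\in\mathcal G_\alpha$ respecting the name of the $\alpha$-th system and $1\Vdash\dot\sigma\in\dot{\mathcal H}_\alpha$; and $\mathcal F_{\alpha+1}$ is the $\omega_1$-completion of a normal filter that contains the head pullbacks $\rho_{\alpha,\alpha+1}^{-1}(H)$, $H\in\mathcal F_\alpha$, and the tail symmetries given by hereditarily symmetric names of members of $\dot{\mathcal K}_\alpha$. - For a limit $\lambda$ with $\mathrm{cf}(\lambda)=\omega$, $\mathcal G_\lambda$ is the inverse limit of the $\mathcal G_\beta$, $\beta<\lambda$, and $\mathcal F_\lambda$ is the normal $\omega_1$-complete filter generated by the head pullbacks: $K\in\mathcal F_\lambda$ iff $\bigcap_{n<\omega}g_nB_ng_n^{-1}\le K$ for some $g_n\in\mathcal G_\lambda$ and some $B_n$ of the form $\rho_{\beta,\lambda}^{-1}(H)$ with $\beta<\lambda$, $H\in\mathcal F_\beta$. - For a limit $\lambda$ with $\mathrm{cf}(\lambda)\ge\omega_1$,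 $\mathcal G_\lambda$ is the direct limit (union) of the $\mathcal G_\beta$, $\beta<\lambda$, and $\mathcal F_\lambda$ is the normal filter generated by the head pullbacks (finite intersections of conjugates instead of countable ones). **Theorem (HS closure under standard name operations).** Let $\lambda\le\Theta$ be a stage of the iteration and $\mathrm{HS}_\lambda=\mathrm{HS}(\mathbb P_\lambda,\mathcal G_\lambda,\mathcal F_\lambda)$. Write $1$ for $1_{\mathbb P_\lambda}$. Then $\mathrm{HS}_\lambda$ is closed under the following operations. 1. *Pairing.* If $\dot x,\dot y\in\mathrm{HS}_\lambda$, then $\{\dot x,\dot y\}^\bullet:=\{\langle\dot x,1\rangle,\langle\dot y,1\rangle\}$ and $\langle\dot x,\dot y\rangle^\bullet:=\{\{\dot x,\dot x\}^\bullet,\{\dot x,\dot y\}^\bullet\}^\bullet$ are in $\mathrm{HS}_\lambda$. 2. *Countable tuples.* If $J\in V$ is countable and $\dot x_j\in\mathrm{HS}_\lambda$ for all $j\in J$, then the name $\{\langle\langle\check\jmath,\dot x_j\rangle^\bullet,1\rangle:j\in J\}$ of the tuple $\langle\dot x_j:j\in J\rangle$ is in $\mathrm{HS}_\lambda$. 3.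 *Union.* If $\dot A\in\mathrm{HS}_\lambda$, then $\{\langle\tau,r\rangle:\exists\langle\sigma,p\rangle\in\dot A\ \exists\langle\tau,q\rangle\in\sigma\ (r\le p,q)\}\in\mathrm{HS}_\lambda$. 4. *Bounded Separation.* If $\varphi(z,u_1,\dots,u_n)$ is a bounded ($\Delta_0$) formula of set theory and $\dot A,\dot u_1,\dots,\dot u_n\in\mathrm{HS}_\lambda$, then the name $\{\langle\sigma,q\rangle:\exists p\,(\langle\sigma,p\rangle\in\dot A,\ q\le p),\ q\Vdash_{\mathbb P_\lambda}\varphi(\sigma,\dot u_1,\dots,\dot u_n)\}$ of $\{z\in\dot A:\varphi(z,\dot u_1,\dots,\dot u_n)\}$ is in $\mathrm{HS}_\lambda$. 5. *Check names.* $\check a=\{\langle\check b,1\rangle:b\in a\}\in\mathrm{HS}_\lambda$ for every $a\in V$. 6. *Other constructors with countably many inputs.* If $\dot x$ is a $\mathbb P_\lambda$-name such that $\dot z\in\mathrm{HS}_\lambda$ for all $\langle\dot z,p\rangle\in\dot x$, and there are $\dot y_n\in\mathrm{HS}_\lambda$ $(n<\omega)$ with $\bigcap_{n<\omega}\mathrm{sym}(\dot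 y_n)\subseteq\mathrm{sym}(\dot x)$, then $\dot x\in\mathrm{HS}_\lambda$. -/

import Mathlib

universe u

/-! ### Filters of subgroups -/

section Filters

variable {Γ : Type*} [Group Γ]

/-- The conjugate subgroup `g H g⁻¹`. -/
def conjSubgroup (g : Γ) (H : Subgroup Γ) : Subgroup Γ :=
  H.map (MulAut.conj g).toMonoidHom

/-- `F` is a normal filter of subgroups of `Γ`. -/
structure IsNormalFilter (F : Set (Subgroup Γ)) : Prop where
  top_mem : ⊤ ∈ F
  mono : ∀ H K : Subgroup Γ, H ∈ F → H ≤ K → K ∈ F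
  inf_mem : ∀ H K : Subgroup Γ, H ∈ F → K ∈ F → H ⊓ K ∈ F
  conj_mem : ∀ (g : Γ) (H : Subgroup Γ), H ∈ F → conjSubgroup g H ∈ F

/-- The `ω₁`-completion of a family of subgroups: all subgroups that contain the intersection of
countably many members. -/
def omegaOneCompletion (F : Set (Subgroup Γ)) : Set (Subgroup Γ) :=
  {K | ∃ H : ℕ → Subgroup Γ, (∀ n, H n ∈ F) ∧ (⨅ n, H n) ≤ K}

/-- The normal filter generated by `B`. -/
def normalFilterGenerated (B : Set (Subgroup Γ)) : Set (Subgroup Γ) :=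
  {K | ∃ (k : ℕ) (H : Fin k → Subgroup Γ) (g : Fin k → Γ),
    (∀ i, H i ∈ B) ∧ (⨅ i, conjSubgroup (g i) (H i)) ≤ K}

/-- The normal `ω₁`-complete filter generated by `B`. -/
def normalOmegaOneFilterGenerated (B : Set (Subgroup Γ)) : Set (Subgroup Γ) :=
  {K | ∃ (H : ℕ → Subgroup Γ) (g : ℕ → Γ),
    (∀ n, H n ∈ B) ∧ (⨅ n, conjSubgroup (g n) (H n)) ≤ K}

end Filters

/-! ### Forcing notions and names

The background universe is `V = ZFSet.{u}`. -/

/-- The type of elements of a set `c`. (Unlike the coercion of `c` to a type, it does not inherit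
the order by inclusion.) -/
@[ext]
structure SetElt (c : ZFSet.{u}) : Type (u + 1) where
  val : ZFSet.{u}
  property : val ∈ c

/-- A forcing notion in `V`: a set of conditions, a reflexive transitive relation, and a top
condition. (Iterations with names produce pre-orders in general; antisymmetric orders are a special
case.) -/
structure ForcingNotion : Type (u + 1) where
  carrier : ZFSet.{u}
  le : SetElt carrier → SetElt carrier → Prop
  one : SetElt carrier
  le_refl : ∀ p, le p p
  le_trans : ∀ p q r, le p q → le q r → le p r
  le_one : ∀ p, le p one

/-- The smallness of the type of pairs coded in a set, needed to form images of names. -/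
theorem small_coded_pairs (x c : ZFSet.{u}) (φ : ZFSet.{u} → SetElt c → Prop)
    (h : ∀ y p, φ y p → ZFSet.pair y p.1 ∈ x) :
    Small.{u} {w : ZFSet.{u} × SetElt c // φ w.1 w.2} := by
  refine small_of_injective (β := {z : ZFSet.{u} // z ∈ x})
    (f := fun w => ⟨ZFSet.pair w.1.1 w.1.2.1, h _ _ w.2⟩) ?_
  rintro ⟨⟨a, p⟩, ha⟩ ⟨⟨b, q⟩, hb⟩ hab
  have := ZFSet.pair_injective (congrArg Subtype.val hab)
  exact Subtype.ext (Prod.ext this.1 (SetElt.ext this.2))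

theorem rank_lt_of_pair_mem {y p x : ZFSet.{u}} (h : ZFSet.pair y p ∈ x) : y.rank < x.rank := by
  have h1 : y ∈ ({y} : ZFSet.{u}) := by simp
  have h2 : ({y} : ZFSet.{u}) ∈ ZFSet.pair y p := by simp [ZFSet.pair]
  exact (ZFSet.rank_lt_of_mem h1).trans ((ZFSet.rank_lt_of_mem h2).trans (ZFSet.rank_lt_of_mem h))

namespace ForcingNotion

variable (P : ForcingNotion.{u})

/-- The conditions of `P`. -/
abbrev Cond : Type (u + 1) := SetElt P.carrier

instance : Preorder P.Cond where
  le := P.le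
  le_refl := P.le_refl
  le_trans := P.le_trans

/-- The automorphism group of `P`. -/
def Aut : Subgroup (Equiv.Perm P.Cond) where
  carrier := {π | (∀ p q, p ≤ q ↔ π p ≤ π q) ∧ π P.one = P.one}
  one_mem' := ⟨fun _ _ => Iff.rfl, rfl⟩
  mul_mem' := by
    rintro a b ⟨ha, ha'⟩ ⟨hb, hb'⟩
    exact ⟨fun p q => (hb p q).trans (ha _ _), by simp [ha', hb']⟩
  inv_mem' := by
    rintro a ⟨ha, ha'⟩
    refine ⟨fun p q => ?_, ?_⟩
    · rw [ha (a⁻¹ p) (a⁻¹ q)]; simp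
    · rw [Equiv.Perm.inv_eq_iff_eq, ha']

/-- `P`-names: sets of pairs `⟨y, p⟩` with `y` a `P`-name and `p ∈ P`. -/
inductive IsName : ZFSet.{u} → Prop
  | mk (x : ZFSet.{u})
      (pairs : ∀ z ∈ x, ∃ (y : ZFSet.{u}) (p : P.Cond), z = ZFSet.pair y p.1)
      (names : ∀ (y : ZFSet.{u}) (p : P.Cond), ZFSet.pair y p.1 ∈ x → IsName y) : IsName x

instance small_pairs (x : ZFSet.{u}) :
    Small.{u} {w : ZFSet.{u} × P.Cond // ZFSet.pair w.1 w.2.1 ∈ x} :=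
  small_coded_pairs x P.carrier (fun y p => ZFSet.pair y p.1 ∈ x) fun _ _ h => h

/-- The recursive action on names: `π x = {⟨π y, π p⟩ : ⟨y, p⟩ ∈ x}`. -/
noncomputable def act (π : Equiv.Perm P.Cond) (x : ZFSet.{u}) : ZFSet.{u} :=
  ZFSet.range fun w : {w : ZFSet.{u} × P.Cond // ZFSet.pair w.1 w.2.1 ∈ x} =>
    ZFSet.pair (act π w.1.1) (π w.1.2).1
termination_by x.rank
decreasing_by exact rank_lt_of_pair_mem w.2

/-- `sym_G(x)`, the stabilizer of `x` in a group `G` of permutations of the conditions. -/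
def sym (G : Subgroup (Equiv.Perm P.Cond)) (x : ZFSet.{u}) : Set G :=
  {g | P.act g.1 x = x}

/-- The hereditarily symmetric names. Symmetry of `x` is `sym_G(x) ∈ F`, where `F` is a family of
subgroups of `G`. -/
inductive HS (G : Subgroup (Equiv.Perm P.Cond)) (F : Set (Subgroup G)) : ZFSet.{u} → Prop
  | mk (x : ZFSet.{u}) (name : P.IsName x)
      (symm : ∃ H ∈ F, (H : Set G) = P.sym G x)
      (hered : ∀ (y : ZFSet.{u}) (p : P.Cond), ZFSet.pair y p.1 ∈ x → HS G F y) : HS G F x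

/-! ### Standard name constructors -/

/-- The name `{⟨x, 1⟩, ⟨y, 1⟩}` of the unordered pair. -/
noncomputable def pairName (x y : ZFSet.{u}) : ZFSet.{u} :=
  {ZFSet.pair x P.one.1, ZFSet.pair y P.one.1}

/-- The name of the (Kuratowski) ordered pair. -/
noncomputable def opName (x y : ZFSet.{u}) : ZFSet.{u} :=
  P.pairName (P.pairName x x) (P.pairName x y)

/-- The check name `ǎ = {⟨b̌, 1⟩ : b ∈ a}`. -/
noncomputable def check (a : ZFSet.{u}) : ZFSet.{u} :=
  ZFSet.range fun b : {b : ZFSet.{u} // b ∈ a} => ZFSet.pair (check b.1) P.one.1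
termination_by a.rank
decreasing_by exact ZFSet.rank_lt_of_mem b.2

/-- The name `{⟨⟨ǰ, x_j⟩, 1⟩ : j ∈ J}` of the tuple `⟨x_j : j ∈ J⟩`. -/
noncomputable def tupleName (J : ZFSet.{u}) (x : {j : ZFSet.{u} // j ∈ J} → ZFSet.{u}) :
    ZFSet.{u} :=
  ZFSet.range fun j : {j : ZFSet.{u} // j ∈ J} =>
    ZFSet.pair (P.opName (P.check j.1) (x j)) P.one.1

/-- The names that occur in `x` as first coordinates. -/
noncomputable def dom (x : ZFSet.{u}) : ZFSet.{u} :=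
  ZFSet.range fun w : {w : ZFSet.{u} × P.Cond // ZFSet.pair w.1 w.2.1 ∈ x} => w.1.1

theorem mem_dom {x y : ZFSet.{u}} : y ∈ P.dom x ↔ ∃ p : P.Cond, ZFSet.pair y p.1 ∈ x := by
  rw [dom, ZFSet.mem_range]
  exact ⟨fun ⟨w, hw⟩ => ⟨w.1.2, hw ▸ w.2⟩, fun ⟨p, hp⟩ => ⟨⟨(y, p), hp⟩, rfl⟩⟩

/-- The union name `{⟨τ, r⟩ : ∃ ⟨σ, p⟩ ∈ A, ∃ ⟨τ, q⟩ ∈ σ, r ≤ p, q}`. -/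
noncomputable def unionName (A : ZFSet.{u}) : ZFSet.{u} :=
  ZFSet.sep
    (fun z => ∃ (τ : ZFSet.{u}) (r : P.Cond), z = ZFSet.pair τ r.1 ∧
      ∃ (σ : ZFSet.{u}) (p q : P.Cond),
        ZFSet.pair σ p.1 ∈ A ∧ ZFSet.pair τ q.1 ∈ σ ∧ r ≤ p ∧ r ≤ q)
    (ZFSet.prod
      (ZFSet.sUnion (ZFSet.range fun σ : {σ : ZFSet.{u} // σ ∈ P.dom A} => P.dom σ.1)) P.carrier)

theorem pair_mem_unionName {A τ : ZFSet.{u}} {r : P.Cond} :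
    ZFSet.pair τ r.1 ∈ P.unionName A ↔
      ∃ (σ : ZFSet.{u}) (p q : P.Cond),
        ZFSet.pair σ p.1 ∈ A ∧ ZFSet.pair τ q.1 ∈ σ ∧ r ≤ p ∧ r ≤ q := by
  rw [unionName, ZFSet.mem_sep]
  constructor
  · rintro ⟨-, τ', r', h, H⟩
    obtain ⟨rfl, h'⟩ := ZFSet.pair_injective h
    obtain rfl := SetElt.ext h'
    exact H
  · rintro ⟨σ, p, q, h1, h2, h3, h4⟩
    refine ⟨ZFSet.mem_prod.2 ⟨τ, ZFSet.mem_sUnion.2 ⟨P.dom σ, ZFSet.mem_range.2 ⟨⟨σ, ?_⟩, rfl⟩, ?_⟩,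
      r.1, r.2, rfl⟩, τ, r, rfl, σ, p, q, h1, h2, h3, h4⟩
    · exact P.mem_dom.2 ⟨p, h1⟩
    · exact P.mem_dom.2 ⟨q, h2⟩

/-- The name `{⟨⟨σ, σ⟩, s⟩ : ⟨σ, s⟩ ∈ A}` of the identity map on the set named by `A`. -/
noncomputable def idName (A : ZFSet.{u}) : ZFSet.{u} :=
  ZFSet.range fun w : {w : ZFSet.{u} × P.Cond // ZFSet.pair w.1 w.2.1 ∈ A} =>
    ZFSet.pair (P.opName w.1.1 w.1.1) w.1.2.1

/-! ### The forcing relation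

A statement of the forcing language is represented by the predicate `p ↦ (p ⊩ statement)`. -/

/-- `p ⊩ a = b`, by recursion on names. -/
def fEq (a b : ZFSet.{u}) (p : P.Cond) : Prop :=
  (∀ (σ : ZFSet.{u}) (s : P.Cond) (_ : ZFSet.pair σ s.1 ∈ a) (q : P.Cond), q ≤ p → q ≤ s →
    ∃ r ≤ q, ∃ (τ : ZFSet.{u}) (t : P.Cond), ZFSet.pair τ t.1 ∈ b ∧ r ≤ t ∧ fEq σ τ r) ∧
  (∀ (τ : ZFSet.{u}) (t : P.Cond), ZFSet.pair τ t.1 ∈ b → ∀ q : P.Cond, q ≤ p → q ≤ t →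
    ∃ r ≤ q, ∃ (σ : ZFSet.{u}) (s : P.Cond) (_ : ZFSet.pair σ s.1 ∈ a), r ≤ s ∧ fEq σ τ r)
termination_by a.rank
decreasing_by all_goals (apply rank_lt_of_pair_mem; assumption)

variable {P}

/-- `p ⊩ a ∈ b`. -/
def fMem (a b : ZFSet.{u}) (p : P.Cond) : Prop :=
  ∀ q ≤ p, ∃ r ≤ q, ∃ (τ : ZFSet.{u}) (t : P.Cond),
    ZFSet.pair τ t.1 ∈ b ∧ r ≤ t ∧ P.fEq a τ r

def fNot (φ : P.Cond → Prop) (p : P.Cond) : Prop := ∀ q ≤ p, ¬ φ q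

def fAnd (φ ψ : P.Cond → Prop) (p : P.Cond) : Prop := φ p ∧ ψ p

/-- Universal quantification over all `P`-names. -/
def fAll (φ : ZFSet.{u} → P.Cond → Prop) (p : P.Cond) : Prop := ∀ x, P.IsName x → φ x p

def fOr (φ ψ : P.Cond → Prop) : P.Cond → Prop := fNot (fAnd (fNot φ) (fNot ψ))

def fImp (φ ψ : P.Cond → Prop) : P.Cond → Prop := fNot (fAnd φ (fNot ψ))

def fIff (φ ψ : P.Cond → Prop) : P.Cond → Prop := fAnd (fImp φ ψ) (fImp ψ φ)

def fEx (φ : ZFSet.{u} → P.Cond → Prop) : P.Cond → Prop := fNot (fAll fun x => fNot (φ x))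

/-- Bounded quantifiers. -/
def fAllIn (a : ZFSet.{u}) (φ : ZFSet.{u} → P.Cond → Prop) : P.Cond → Prop :=
  fAll fun x => fImp (fMem x a) (φ x)

def fExIn (a : ZFSet.{u}) (φ : ZFSet.{u} → P.Cond → Prop) : P.Cond → Prop :=
  fEx fun x => fAnd (fMem x a) (φ x)

def fSubset (a b : ZFSet.{u}) : P.Cond → Prop := fAllIn a fun x => fMem x b

/-- "`⟨x, y⟩ ∈ f`". -/
def fApp (f x y : ZFSet.{u}) : P.Cond → Prop := fMem (P.opName x y) f

end ForcingNotion

infixr:35 " ⋏ " => ForcingNotion.fAnd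
infixr:30 " ⇛ " => ForcingNotion.fImp

/-- Bounded (`Δ₀`) formulas of the language of set theory with `n` free variables, built from
`∈`, `=`, `¬`, `∧` and `∀ x ∈ v_i`. The remaining connectives and `∃ x ∈ v_i` are abbreviations.
In `ball i φ` the variable `0` of `φ` is the bound one. -/
inductive Delta0Formula : ℕ → Type
  | mem {n : ℕ} (i j : Fin n) : Delta0Formula n
  | eq {n : ℕ} (i j : Fin n) : Delta0Formula n
  | neg {n : ℕ} (φ : Delta0Formula n) : Delta0Formula n
  | and {n : ℕ} (φ ψ : Delta0Formula n) : Delta0Formula n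
  | ball {n : ℕ} (i : Fin n) (φ : Delta0Formula (n + 1)) : Delta0Formula n

namespace ForcingNotion

variable {P : ForcingNotion.{u}}

/-- `p ⊩ φ(v)` for a bounded formula `φ` and names `v`. -/
def forces : {n : ℕ} → Delta0Formula n → (Fin n → ZFSet.{u}) → P.Cond → Prop
  | _, .mem i j, v => fMem (v i) (v j)
  | _, .eq i j, v => P.fEq (v i) (v j)
  | _, .neg φ, v => fNot (forces φ v)
  | _, .and φ ψ, v => forces φ v ⋏ forces ψ v
  | _, .ball i φ, v => fAllIn (v i) fun x => forces φ (Fin.cons x v)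

variable (P)

/-- The standard name of `{z ∈ A : φ(z, u)}`, namely
`{⟨σ, q⟩ : ∃ p, ⟨σ, p⟩ ∈ A, q ≤ p, q ⊩ φ(σ, u)}`. The variable `0` of `φ` is `z`. -/
noncomputable def sepName {n : ℕ} (φ : Delta0Formula (n + 1)) (A : ZFSet.{u})
    (v : Fin n → ZFSet.{u}) : ZFSet.{u} :=
  ZFSet.sep
    (fun z => ∃ (σ : ZFSet.{u}) (q : P.Cond), z = ZFSet.pair σ q.1 ∧
      (∃ p : P.Cond, ZFSet.pair σ p.1 ∈ A ∧ q ≤ p) ∧ forces φ (Fin.cons σ v) q)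
    (ZFSet.prod (P.dom A) P.carrier)

theorem pair_mem_sepName {n : ℕ} {φ : Delta0Formula (n + 1)} {A : ZFSet.{u}}
    {v : Fin n → ZFSet.{u}} {σ : ZFSet.{u}} {q : P.Cond} :
    ZFSet.pair σ q.1 ∈ P.sepName φ A v ↔
      (∃ p : P.Cond, ZFSet.pair σ p.1 ∈ A ∧ q ≤ p) ∧ forces φ (Fin.cons σ v) q := by
  rw [sepName, ZFSet.mem_sep]
  constructor
  · rintro ⟨-, σ', q', h, H⟩
    obtain ⟨rfl, h'⟩ := ZFSet.pair_injective h
    obtain rfl := SetElt.ext h'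
    exact H
  · rintro ⟨⟨p, hp, hq⟩, H⟩
    exact ⟨ZFSet.mem_prod.2 ⟨σ, P.mem_dom.2 ⟨p, hp⟩, q.1, q.2, rfl⟩, σ, q, rfl, ⟨p, hp, hq⟩, H⟩

variable {P}

/-! ### "`⟨Q, H, K⟩` is a symmetric system" in the forcing language

`Q` is the set of conditions, `L` the order (a set of ordered pairs), `o` the top condition, `H`
the group (a set of functions, as sets of ordered pairs) and `K` the filter. -/

/-- `L` is a reflexive and transitive relation on `Q` with top element `o`. -/
def fIsForcingNotion (Q L o : ZFSet.{u}) : P.Cond → Prop :=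
  fMem o Q ⋏
  (fAllIn Q fun x => fApp L x x ⋏ fApp L x o) ⋏
  (fAllIn Q fun x => fAllIn Q fun y => fAllIn Q fun z => fApp L x y ⇛ fApp L y z ⇛ fApp L x z)

/-- `h` is an automorphism of `(Q, L, o)`. -/
def fIsAut (Q L o h : ZFSet.{u}) : P.Cond → Prop :=
  (fAllIn h fun z => fExIn Q fun x => fExIn Q fun y => P.fEq z (P.opName x y)) ⋏
  (fAllIn Q fun x => fExIn Q fun y => fApp h x y) ⋏
  (fAllIn Q fun y => fExIn Q fun x => fApp h x y) ⋏
  (fAll fun x => fAll fun y => fAll fun y' => fApp h x y ⇛ fApp h x y' ⇛ P.fEq y y') ⋏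
  (fAll fun x => fAll fun x' => fAll fun y => fApp h x y ⇛ fApp h x' y ⇛ P.fEq x x') ⋏
  (fAll fun x => fAll fun x' => fAll fun y => fAll fun y' =>
    fApp h x y ⇛ fApp h x' y' ⇛ fIff (fApp L x x') (fApp L y y')) ⋏
  fApp h o o

/-- `k = g ∘ h`, for relations. -/
def fIsComp (k g h : ZFSet.{u}) : P.Cond → Prop :=
  fAll fun x => fAll fun y => fIff (fApp k x y) (fEx fun z => fApp h x z ⋏ fApp g z y)

/-- `M` is a group of automorphisms of `(Q, L, o)`. -/
def fIsAutGroup (Q L o M : ZFSet.{u}) : P.Cond → Prop :=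
  (fAllIn M fun h => fIsAut Q L o h) ⋏
  (fExIn M fun e => fAll fun x => fAll fun y => fIff (fApp e x y) (fMem x Q ⋏ P.fEq x y)) ⋏
  (fAllIn M fun g => fAllIn M fun h => fExIn M fun k => fIsComp k g h) ⋏
  (fAllIn M fun g => fExIn M fun k => fAll fun x => fAll fun y => fIff (fApp k x y) (fApp g y x))

/-- `M` is a subgroup of the automorphism group `H`. -/
def fIsSubgroup (Q L o H M : ZFSet.{u}) : P.Cond → Prop :=
  fSubset M H ⋏ fIsAutGroup Q L o M

/-- `N = g M g⁻¹`, for subgroups of `H`: `N` is the set of `x ∈ H` with `x g = g m` for some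
`m ∈ M`. -/
def fIsConj (H N g M : ZFSet.{u}) : P.Cond → Prop :=
  fAll fun x => fIff (fMem x N)
    (fMem x H ⋏ fExIn M fun m => fEx fun k => fIsComp k x g ⋏ fIsComp k g m)

/-- `K` is a normal filter of subgroups of `H`. -/
def fIsNormalFilter (Q L o H K : ZFSet.{u}) : P.Cond → Prop :=
  (fAllIn K fun M => fIsSubgroup Q L o H M) ⋏
  fMem H K ⋏
  (fAllIn K fun M => fAll fun N => fIsSubgroup Q L o H N ⇛ fSubset M N ⇛ fMem N K) ⋏
  (fAllIn K fun M => fAllIn K fun N => fAll fun R =>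
    (fAll fun x => fIff (fMem x R) (fMem x M ⋏ fMem x N)) ⇛ fMem R K) ⋏
  (fAllIn K fun M => fAllIn H fun g => fAll fun N => fIsConj H N g M ⇛ fMem N K)

/-- `⟨(Q, L, o), H, K⟩` is a symmetric system. -/
def fIsSymmetricSystem (Q L o H K : ZFSet.{u}) : P.Cond → Prop :=
  fIsForcingNotion Q L o ⋏ fIsAutGroup Q L o H ⋏ fIsNormalFilter Q L o H K

end ForcingNotion

/-! ### Countable-support symmetric iterations -/

/-- The support of a condition `p`, i.e. the domain of the partial function `p`. -/
def csupp (p : ZFSet.{u}) : Set Ordinal.{u} := {β | ∃ n, ZFSet.pair β.toZFSet n ∈ p}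

/-- The restriction `p ↾ β`. -/
noncomputable def crestr (p : ZFSet.{u}) (β : Ordinal.{u}) : ZFSet.{u} :=
  ZFSet.sep (fun z => ∃ γ < β, ∃ n, z = ZFSet.pair γ.toZFSet n) p

/-- The data of a symmetric iteration: forcing notions `P α`, groups `G α`, families `F α` of
subgroups and restriction maps `ρ β α : G α → G β`; the components of the `P α`-names
`⟨Q α, H α, K α⟩` (with order `leQ α` and top condition `oneQ α` on `Q α`); and a set `C α` of
`P α`-names from which the values of conditions at coordinate `α` are taken. -/
structure IterationData : Type (u + 1) where
  P : Ordinal.{u} → ForcingNotion.{u}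
  G : ∀ α, Subgroup (Equiv.Perm (P α).Cond)
  F : ∀ α, Set (Subgroup (G α))
  ρ : ∀ β α, G α →* G β
  Q : Ordinal.{u} → ZFSet.{u}
  leQ : Ordinal.{u} → ZFSet.{u}
  oneQ : Ordinal.{u} → ZFSet.{u}
  H : Ordinal.{u} → ZFSet.{u}
  K : Ordinal.{u} → ZFSet.{u}
  C : Ordinal.{u} → ZFSet.{u}

namespace IterationData

open ForcingNotion

variable (S : IterationData.{u})

/-- The hereditarily symmetric names of stage `α`. -/
def HSAt (α : Ordinal.{u}) : ZFSet.{u} → Prop := (S.P α).HS (S.G α) (S.F α)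

/-- `p` is a condition of the countable-support iteration of length `α`: a partial function on `α`
with countable domain such that `p(β) ∈ C β` and `p ↾ β ⊩ p(β) ∈ Q β`. -/
def IsCondition (α : Ordinal.{u}) (p : ZFSet.{u}) : Prop :=
  (∀ z ∈ p, ∃ β < α, ∃ n, z = ZFSet.pair β.toZFSet n) ∧
  (∀ (β : Ordinal.{u}) (n m : ZFSet.{u}),
    ZFSet.pair β.toZFSet n ∈ p → ZFSet.pair β.toZFSet m ∈ p → n = m) ∧
  (csupp p).Countable ∧
  ∀ (β : Ordinal.{u}) (n : ZFSet.{u}), ZFSet.pair β.toZFSet n ∈ p →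
    n ∈ S.C β ∧ ∃ h : crestr p β ∈ (S.P β).carrier, fMem (P := S.P β) n (S.Q β) ⟨crestr p β, h⟩

/-- `q ≤ p` in the iteration: `dom q ⊇ dom p` and `q ↾ β ⊩ q(β) ≤ p(β)` for `β ∈ dom p`. -/
def CondLE (q p : ZFSet.{u}) : Prop :=
  csupp p ⊆ csupp q ∧
  ∀ (β : Ordinal.{u}) (n m : ZFSet.{u}),
    ZFSet.pair β.toZFSet n ∈ p → ZFSet.pair β.toZFSet m ∈ q →
      ∃ h : crestr q β ∈ (S.P β).carrier,
        fApp (P := S.P β) (S.leQ β) m n ⟨crestr q β, h⟩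

/-- `π` respects the name of the `α`-th symmetric system. -/
def Respects (α : Ordinal.{u}) (π : Equiv.Perm (S.P α).Cond) : Prop :=
  ∀ a ∈ ({S.Q α, S.leQ α, S.oneQ α, S.H α, S.K α} : Set ZFSet.{u}),
    (S.P α).fEq ((S.P α).act π a) a (S.P α).one

/-- `g` is the permutation `(p, n) ↦ (π p, π(σ(n)))` of `P (α + 1) = P α * Q α`, where `σ` is a
`P α`-name of a permutation of `Q α`. Here `m'` is a name for `σ(n)`, and the value of `g p` at `α`
is a name forced to equal `π m'`. -/
def Induces (α : Ordinal.{u}) (g : Equiv.Perm (S.P (α + 1)).Cond)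
    (π : Equiv.Perm (S.P α).Cond) (σ : ZFSet.{u}) : Prop :=
  ∀ (p : (S.P (α + 1)).Cond) (p₀ : (S.P α).Cond), p₀.1 = crestr p.1 α →
    (π p₀).1 = crestr (g p).1 α ∧
    (α ∈ csupp p.1 ↔ α ∈ csupp (g p).1) ∧
    ∀ n, ZFSet.pair α.toZFSet n ∈ p.1 →
      ∃ m m' : ZFSet.{u}, ZFSet.pair α.toZFSet m ∈ (g p).1 ∧ (S.P α).IsName m' ∧
        fApp σ n m' p₀ ∧ (S.P α).fEq m ((S.P α).act π m') (π p₀)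

/-- The subgroup of `G (α + 1)` of tail symmetries coming from a name `M` of a member of `K α`. -/
def tailSubgroup (α : Ordinal.{u}) (M : ZFSet.{u}) : Subgroup (S.G (α + 1)) :=
  Subgroup.closure {g | S.ρ α (α + 1) g ∈ (S.P α).sym (S.G α) M ∧
    ∃ σ, (S.P α).IsName σ ∧ fMem (P := S.P α) σ M (S.P α).one ∧
      S.Induces α g.1 (S.ρ α (α + 1) g).1 σ}

/-- The head pullbacks `ρ_{β,α}⁻¹(H)` with `β < α` and `H ∈ F β`. -/
def headPullbacks (α : Ordinal.{u}) : Set (Subgroup (S.G α)) :=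
  {B | ∃ β < α, ∃ H ∈ S.F β, B = H.comap (S.ρ β α)}

/-- `g` is a coherent sequence of elements of `G β`, `β < α`. -/
def IsThread (α : Ordinal.{u}) (g : ∀ β, S.G β) : Prop :=
  ∀ γ β, γ ≤ β → β < α → S.ρ γ β (g β) = g γ

/-- The thread `g` comes from an element of `G α`. -/
def ThreadRealized (α : Ordinal.{u}) (g : ∀ β, S.G β) : Prop :=
  ∃ a : S.G α, ∀ β < α, S.ρ β α a = g β

/-- The thread `g` of length `α` is trivial at all coordinates from some `β < α` on, i.e. it comes
from an element of the earlier group `G β`. -/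
def EventuallyTrivial (α : Ordinal.{u}) (g : ∀ β, S.G β) : Prop :=
  ∃ β < α, ∀ γ, β ≤ γ → γ < α →
    S.Induces γ (g (γ + 1)).1 (g γ).1 ((S.P γ).idName (S.Q γ))

/-- `S` is a countable-support symmetric iteration of length `Θ`. -/
structure IsCSIteration (Θ : Ordinal.{u}) : Prop where
  /-- The `P α` form the countable-support iteration of the `Q α`. In particular `P 0 = {∅}`,
  `P (α + 1)` is `P α * Q α`, and `P α` is the union of the earlier stages if `cf α > ω`. -/
  mem_P : ∀ α ≤ Θ, ∀ p : ZFSet.{u}, p ∈ (S.P α).carrier ↔ S.IsCondition α p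
  le_P : ∀ α ≤ Θ, ∀ q p : (S.P α).Cond, q ≤ p ↔ S.CondLE q.1 p.1
  one_P : ∀ α ≤ Θ, (S.P α).one.1 = ∅
  /-- `1 ⊩ ⟨Q α, H α, K α⟩ is a symmetric system`. -/
  isName : ∀ α < Θ, ∀ a ∈ ({S.Q α, S.leQ α, S.oneQ α, S.H α, S.K α} : Set ZFSet.{u}),
    (S.P α).IsName a
  symmetricSystem : ∀ α < Θ,
    fIsSymmetricSystem (P := S.P α) (S.Q α) (S.leQ α) (S.oneQ α) (S.H α) (S.K α) (S.P α).one
  /-- `C α` is a set of names that represents, densely, all names of conditions in `Q α`. -/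
  isName_C : ∀ α < Θ, ∀ n ∈ S.C α, (S.P α).IsName n
  full_C : ∀ α < Θ, ∀ (τ : ZFSet.{u}) (p : (S.P α).Cond), (S.P α).IsName τ → fMem τ (S.Q α) p →
    ∃ q ≤ p, ∃ n ∈ S.C α, (S.P α).fEq n τ q
  /-- The groups consist of automorphisms, and `ρ` is restriction. -/
  G_le : ∀ α ≤ Θ, S.G α ≤ (S.P α).Aut
  ρ_spec : ∀ β α, β ≤ α → α ≤ Θ → ∀ (g : S.G α) (p : (S.P α).Cond) (q : (S.P β).Cond),
    q.1 = crestr p.1 β → ((S.ρ β α g).1 q).1 = crestr (g.1 p).1 β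
  ρ_comp : ∀ γ β α, γ ≤ β → β ≤ α → α ≤ Θ → ∀ g : S.G α, S.ρ γ β (S.ρ β α g) = S.ρ γ α g
  /-- `F 0 = {G 0}`. -/
  F_zero : S.F 0 = {⊤}
  /-- `G (α + 1)` is the two-step group of all `(p, n) ↦ (π p, π(σ(n)))`, where `π ∈ G α` respects
  `⟨Q α, H α, K α⟩` and `1 ⊩ σ ∈ H α`. -/
  G_succ : ∀ α < Θ, ∀ g : S.G (α + 1), S.Respects α (S.ρ α (α + 1) g).1 ∧
    ∃ σ, (S.P α).IsName σ ∧ fMem (P := S.P α) σ (S.H α) (S.P α).one ∧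
      S.Induces α g.1 (S.ρ α (α + 1) g).1 σ
  G_succ_full : ∀ α < Θ, ∀ π : S.G α, S.Respects α π.1 → ∀ σ, (S.P α).IsName σ →
    fMem (P := S.P α) σ (S.H α) (S.P α).one → ∃ g : S.G (α + 1), S.Induces α g.1 π.1 σ
  /-- `F (α + 1)` is the `ω₁`-completion of a normal filter that extends the head pullbacks and
  the tail symmetries. -/
  F_succ : ∀ α < Θ, ∃ E : Set (Subgroup (S.G (α + 1))), IsNormalFilter E ∧
    (∀ H ∈ S.F α, H.comap (S.ρ α (α + 1)) ∈ E) ∧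
    (∀ M, S.HSAt α M → fMem (P := S.P α) M (S.K α) (S.P α).one → S.tailSubgroup α M ∈ E) ∧
    S.F (α + 1) = omegaOneCompletion E
  /-- Limits of countable cofinality: `G α` is the inverse limit, and `F α` is the normal
  `ω₁`-complete filter generated by the head pullbacks. -/
  G_lim_countable : ∀ α ≤ Θ, Order.IsSuccLimit α → α.cof = Cardinal.aleph0 →
    ∀ g : ∀ β, S.G β, S.IsThread α g → S.ThreadRealized α g
  F_lim_countable : ∀ α ≤ Θ, Order.IsSuccLimit α → α.cof = Cardinal.aleph0 →
    S.F α = normalOmegaOneFilterGenerated (S.headPullbacks α)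
  /-- Limits of uncountable cofinality: `G α` is the direct limit, and `F α` is the normal filter
  generated by the head pullbacks. -/
  G_lim_uncountable : ∀ α ≤ Θ, Order.IsSuccLimit α → Cardinal.aleph0 < α.cof →
    ∀ g : ∀ β, S.G β, S.IsThread α g → (S.ThreadRealized α g ↔ S.EventuallyTrivial α g)
  F_lim_uncountable : ∀ α ≤ Θ, Order.IsSuccLimit α → Cardinal.aleph0 < α.cof →
    S.F α = normalFilterGenerated (S.headPullbacks α)

end IterationData

/-!
At every stage `α ≤ Θ` the family `F α` is an `ω₁`-complete normal filter, so a name is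
hereditarily symmetric as soon as its members are and its stabilizer contains the intersection of
the stabilizers of countably many hereditarily symmetric names (`ForcingNotion.HS.of_sym`). Each of
the listed operations is equivariant under automorphisms of the forcing notion, so the constructed
name is fixed by every group element that fixes the countably many inputs. For bounded Separation
the equivariance is the symmetry lemma `p ⊩ φ(v) ↔ π p ⊩ φ(π v)` (`ForcingNotion.forces_act`).

The completeness of `F α` is proved by induction on `α`, together with the fact that the pullbacks
to stage `α` of members of earlier filters lie in `F α`
(`IterationData.IsCSIteration.filter_properties`). At successors and at limits of cofinality `ω` it
is built into the definition. At a limit of uncountable cofinality only finite intersections of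
conjugates of head pullbacks are allowed. There a conjugate of a head pullback is the head pullback
of a conjugate, and countably many head pullbacks come from a common earlier stage, whose filter is
`ω₁`-complete by the induction hypothesis. So the head pullbacks themselves are closed under
conjugation and countable intersections, and `F α` is their upward closure.
-/

/-! ### Complete normal filters of subgroups -/

section Filters

variable {Γ : Type*} [Group Γ]

theorem mem_conjSubgroup {g x : Γ} {H : Subgroup Γ} :
    x ∈ conjSubgroup g H ↔ g⁻¹ * x * g ∈ H := by
  constructor
  · rintro ⟨y, hy, rfl⟩
    simpa [mul_assoc] using hy
  · intro h
    exact ⟨_, h, by simp [mul_assoc]⟩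

theorem conjSubgroup_iInf {ι : Sort*} (g : Γ) (H : ι → Subgroup Γ) :
    conjSubgroup g (⨅ i, H i) = ⨅ i, conjSubgroup g (H i) := by
  ext x
  simp [mem_conjSubgroup, Subgroup.mem_iInf]

theorem conjSubgroup_mono (g : Γ) {H K : Subgroup Γ} (h : H ≤ K) :
    conjSubgroup g H ≤ conjSubgroup g K :=
  Subgroup.map_mono h

theorem conjSubgroup_one (H : Subgroup Γ) : conjSubgroup 1 H = H := by
  ext x
  simp [mem_conjSubgroup]

theorem conjSubgroup_conjSubgroup (a b : Γ) (H : Subgroup Γ) :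
    conjSubgroup a (conjSubgroup b H) = conjSubgroup (a * b) H := by
  ext x
  simp [mem_conjSubgroup, mul_assoc]

theorem conjSubgroup_comap {Δ : Type*} [Group Δ] (f : Γ →* Δ) (g : Γ) (H : Subgroup Δ) :
    conjSubgroup g (H.comap f) = (conjSubgroup (f g) H).comap f := by
  ext x
  simp [mem_conjSubgroup]

/-- `F` is an `ω₁`-complete normal filter of subgroups. -/
structure IsCompleteNormalFilter (F : Set (Subgroup Γ)) : Prop extends IsNormalFilter F where
  iInf_nat_mem : ∀ H : ℕ → Subgroup Γ, (∀ n, H n ∈ F) → ⨅ n, H n ∈ F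

theorem IsCompleteNormalFilter.iInf_mem {F : Set (Subgroup Γ)} (hF : IsCompleteNormalFilter F)
    {ι : Type*} [Countable ι] (H : ι → Subgroup Γ) (hH : ∀ i, H i ∈ F) : ⨅ i, H i ∈ F := by
  cases isEmpty_or_nonempty ι with
  | inl h =>
    rw [iInf_of_empty]
    exact hF.top_mem
  | inr h =>
    obtain ⟨f, hf⟩ := exists_surjective_nat ι
    rw [← hf.iInf_comp]
    exact hF.iInf_nat_mem _ fun n => hH _

theorem isCompleteNormalFilter_of_basis {F B : Set (Subgroup Γ)} (hne : B.Nonempty)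
    (hconj : ∀ (g : Γ), ∀ H ∈ B, conjSubgroup g H ∈ B)
    (hinf : ∀ H : ℕ → Subgroup Γ, (∀ n, H n ∈ B) → ⨅ n, H n ∈ B)
    (hF : ∀ K, K ∈ F ↔ ∃ H ∈ B, H ≤ K) : IsCompleteNormalFilter F where
  top_mem := (hF _).2 (hne.imp fun _ h => ⟨h, le_top⟩)
  mono H K hH hK := by
    obtain ⟨L, hL, hLH⟩ := (hF _).1 hH
    exact (hF _).2 ⟨L, hL, hLH.trans hK⟩
  inf_mem H K hH hK := by
    obtain ⟨L, hL, hLH⟩ := (hF _).1 hH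
    obtain ⟨M, hM, hMK⟩ := (hF _).1 hK
    refine (hF _).2 ⟨⨅ n : ℕ, if n = 0 then L else M, hinf _ fun n => ?_, le_inf ?_ ?_⟩
    · split_ifs <;> assumption
    · exact (iInf_le _ 0).trans (by simpa using hLH)
    · exact (iInf_le _ 1).trans (by simpa using hMK)
  conj_mem g H hH := by
    obtain ⟨L, hL, hLH⟩ := (hF _).1 hH
    exact (hF _).2 ⟨_, hconj g L hL, conjSubgroup_mono g hLH⟩
  iInf_nat_mem H hH := by
    choose L hL hLH using fun n => (hF _).1 (hH n)
    exact (hF _).2 ⟨_, hinf L hL, iInf_mono hLH⟩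

/-- Countable intersections of countable intersections are countable intersections. -/
theorem exists_iInf_eq_of_forall_exists {B : Set (Subgroup Γ)} (H : ℕ → Subgroup Γ)
    (hH : ∀ n, ∃ L : ℕ → Subgroup Γ, (∀ m, L m ∈ B) ∧ ⨅ m, L m = H n) :
    ∃ L : ℕ → Subgroup Γ, (∀ m, L m ∈ B) ∧ ⨅ m, L m = ⨅ n, H n := by
  choose L hL hLH using hH
  refine ⟨fun k => L (Nat.pairEquiv.symm k).1 (Nat.pairEquiv.symm k).2, fun k => hL _ _, ?_⟩
  exact (Nat.pairEquiv.symm.surjective.iInf_comp fun m : ℕ × ℕ => L m.1 m.2).trans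
    (by simp [iInf_prod, hLH])

/-- The countable intersections of members of `B` are a basis of a complete normal filter, if `B` is
nonempty and closed under conjugation. -/
theorem isCompleteNormalFilter_of_countable_basis {F B : Set (Subgroup Γ)} (hne : B.Nonempty)
    (hconj : ∀ (g : Γ), ∀ H ∈ B, conjSubgroup g H ∈ B)
    (hF : ∀ K, K ∈ F ↔ ∃ H : ℕ → Subgroup Γ, (∀ n, H n ∈ B) ∧ ⨅ n, H n ≤ K) :
    IsCompleteNormalFilter F := by
  refine isCompleteNormalFilter_of_basis
    (B := {K | ∃ H : ℕ → Subgroup Γ, (∀ n, H n ∈ B) ∧ ⨅ n, H n = K}) ?_ ?_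
    exists_iInf_eq_of_forall_exists fun K => ?_
  · obtain ⟨H, hH⟩ := hne
    exact ⟨_, fun _ => H, fun _ => hH, rfl⟩
  · rintro g - ⟨H, hH, rfl⟩
    exact ⟨_, fun n => hconj g _ (hH n), (conjSubgroup_iInf g H).symm⟩
  · rw [hF]
    constructor
    · rintro ⟨H, hH, hK⟩
      exact ⟨_, ⟨H, hH, rfl⟩, hK⟩
    · rintro ⟨-, ⟨H, hH, rfl⟩, hK⟩
      exact ⟨H, hH, hK⟩

theorem IsNormalFilter.isCompleteNormalFilter_omegaOneCompletion {E : Set (Subgroup Γ)}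
    (hE : IsNormalFilter E) : IsCompleteNormalFilter (omegaOneCompletion E) :=
  isCompleteNormalFilter_of_countable_basis ⟨_, hE.top_mem⟩ hE.conj_mem fun _ => Iff.rfl

theorem subset_omegaOneCompletion (E : Set (Subgroup Γ)) : E ⊆ omegaOneCompletion E :=
  fun H hH => ⟨fun _ => H, fun _ => hH, by simp⟩

theorem isCompleteNormalFilter_normalOmegaOneFilterGenerated {B : Set (Subgroup Γ)}
    (hne : B.Nonempty) : IsCompleteNormalFilter (normalOmegaOneFilterGenerated B) := by
  refine isCompleteNormalFilter_of_countable_basis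
    (B := {K | ∃ H ∈ B, ∃ g, conjSubgroup g H = K}) ?_ ?_ fun K => ?_
  · obtain ⟨H, hH⟩ := hne
    exact ⟨_, H, hH, 1, rfl⟩
  · rintro a - ⟨H, hH, g, rfl⟩
    exact ⟨H, hH, a * g, (conjSubgroup_conjSubgroup a g H).symm⟩
  · constructor
    · rintro ⟨H, g, hH, hK⟩
      exact ⟨_, fun n => ⟨H n, hH n, g n, rfl⟩, hK⟩
    · rintro ⟨L, hL, hK⟩
      choose H hH g hg using hL
      exact ⟨H, g, hH, by simpa [hg] using hK⟩

theorem subset_normalOmegaOneFilterGenerated (B : Set (Subgroup Γ)) :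
    B ⊆ normalOmegaOneFilterGenerated B :=
  fun H hH => ⟨fun _ => H, fun _ => 1, fun _ => hH, by simp [conjSubgroup_one]⟩

theorem subset_normalFilterGenerated (B : Set (Subgroup Γ)) : B ⊆ normalFilterGenerated B :=
  fun H hH => ⟨1, fun _ => H, fun _ => 1, fun _ => hH, by simp [conjSubgroup_one]⟩

/-- The finitary generated filter is already `ω₁`-complete if the generating family is closed under
conjugation and countable intersections. -/
theorem isCompleteNormalFilter_normalFilterGenerated {B : Set (Subgroup Γ)} (hne : B.Nonempty)
    (hconj : ∀ (g : Γ), ∀ H ∈ B, conjSubgroup g H ∈ B)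
    (hinf : ∀ H : ℕ → Subgroup Γ, (∀ n, H n ∈ B) → ⨅ n, H n ∈ B) :
    IsCompleteNormalFilter (normalFilterGenerated B) := by
  refine isCompleteNormalFilter_of_basis hne hconj hinf fun K => ⟨?_, ?_⟩
  · rintro ⟨k, H, g, hH, hK⟩
    obtain ⟨L, hL⟩ := hne
    -- A finite family is padded to a sequence by a fixed member `L` of `B`.
    refine ⟨⨅ n : ℕ, if h : n < k then conjSubgroup (g ⟨n, h⟩) (H ⟨n, h⟩) else L,
      hinf _ fun n => ?_, le_trans (le_iInf fun i => ?_) hK⟩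
    · split_ifs with h
      exacts [hconj _ _ (hH _), hL]
    · exact (iInf_le _ (i : ℕ)).trans (by simp)
  · rintro ⟨H, hH, hK⟩
    obtain ⟨k, L, g, hL, hLH⟩ := subset_normalFilterGenerated B hH
    exact ⟨k, L, g, hL, hLH.trans hK⟩

end Filters

/-! ### The filters of an iteration -/

namespace IterationData

variable {S : IterationData.{u}} {Θ : Ordinal.{u}}

theorem conjSubgroup_mem_headPullbacks {α : Ordinal.{u}}
    (hF : ∀ β < α, IsNormalFilter (S.F β)) (g : S.G α) {B : Subgroup (S.G α)}
    (hB : B ∈ S.headPullbacks α) : conjSubgroup g B ∈ S.headPullbacks α := by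
  obtain ⟨β, hβ, H, hH, rfl⟩ := hB
  exact ⟨β, hβ, _, (hF β hβ).conj_mem (S.ρ β α g) H hH, conjSubgroup_comap _ _ _⟩

theorem IsCSIteration.comap_comap_ρ (hS : S.IsCSIteration Θ) {γ β α : Ordinal.{u}} (h₁ : γ ≤ β)
    (h₂ : β ≤ α) (h₃ : α ≤ Θ) (H : Subgroup (S.G γ)) :
    (H.comap (S.ρ γ β)).comap (S.ρ β α) = H.comap (S.ρ γ α) := by
  ext g
  simp [hS.ρ_comp γ β α h₁ h₂ h₃ g]

/-- Countably many head pullbacks at a limit of uncountable cofinality come from a common earlier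
stage. -/
theorem IsCSIteration.iInf_mem_headPullbacks (hS : S.IsCSIteration Θ) {α : Ordinal.{u}}
    (hα : α ≤ Θ) (hlim : Order.IsSuccLimit α) (hcof : Cardinal.aleph0 < α.cof)
    (hF : ∀ β < α, IsCompleteNormalFilter (S.F β) ∧ S.headPullbacks β ⊆ S.F β)
    (B : ℕ → Subgroup (S.G α)) (hB : ∀ n, B n ∈ S.headPullbacks α) :
    ⨅ n, B n ∈ S.headPullbacks α := by
  choose β hβ H hH hBH using hB
  obtain ⟨δ, hδ, hβδ⟩ : ∃ δ < α, ∀ n, β n < δ := by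
    have hsup : ⨆ n, β n < α := Ordinal.lift_iSup_lt_of_lt_cof (by simpa using hcof) hβ
    refine ⟨_, hlim.succ_lt hsup, fun n => Order.lt_succ_of_le ?_⟩
    exact le_ciSup (Ordinal.bddAbove_of_small) n
  refine ⟨δ, hδ, ⨅ n, (H n).comap (S.ρ (β n) δ), (hF δ hδ).1.iInf_nat_mem _ fun n =>
    (hF δ hδ).2 ⟨β n, hβδ n, H n, hH n, rfl⟩, ?_⟩
  rw [Subgroup.comap_iInf]
  refine iInf_congr fun n => ?_
  rw [hBH n, hS.comap_comap_ρ (hβδ n).le hδ.le hα]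

/-- Every filter of a countable-support symmetric iteration is an `ω₁`-complete normal filter, and
contains the pullbacks of the members of the earlier filters. -/
theorem IsCSIteration.filter_properties (hS : S.IsCSIteration Θ) (α : Ordinal.{u}) (hα : α ≤ Θ) :
    IsCompleteNormalFilter (S.F α) ∧ S.headPullbacks α ⊆ S.F α := by
  induction α using WellFoundedLT.induction with
  | ind α ih =>
  rcases Ordinal.zero_or_succ_or_isSuccLimit α with rfl | ⟨α, rfl⟩ | hlim
  · refine ⟨isCompleteNormalFilter_of_basis (B := {⊤}) ⟨⊤, rfl⟩ ?_ ?_ ?_, ?_⟩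
    · rintro g - rfl
      ext x
      simp [mem_conjSubgroup]
    · intro H hH
      simp only [Set.mem_singleton_iff] at hH
      simp [hH]
    · simp [hS.F_zero]
    · rintro - ⟨β, hβ, -⟩
      exact absurd hβ not_lt_zero
  · rw [Order.succ_eq_add_one] at *
    have hlt : α < Θ := (Order.lt_add_one_iff.2 le_rfl).trans_le hα
    obtain ⟨E, hE, hhead, -, hFE⟩ := hS.F_succ α hlt
    rw [hFE]
    refine ⟨hE.isCompleteNormalFilter_omegaOneCompletion, ?_⟩
    rintro - ⟨β, hβ, H, hH, rfl⟩
    apply subset_omegaOneCompletion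
    rcases (Order.lt_add_one_iff.1 hβ).eq_or_lt with rfl | hβα
    · exact hhead H hH
    · rw [← hS.comap_comap_ρ hβα.le (Order.lt_add_one_iff.2 le_rfl).le hα]
      exact hhead _ ((ih α (Order.lt_succ α) hlt.le).2 ⟨β, hβα, H, hH, rfl⟩)
  · have ih' := fun β (hβ : β < α) => ih β hβ (hβ.le.trans hα)
    have hne : (S.headPullbacks α).Nonempty :=
      ⟨_, 0, hlim.bot_lt, ⊤, (ih' 0 hlim.bot_lt).1.top_mem, rfl⟩
    rcases (Ordinal.aleph0_le_cof_iff.2 (Ordinal.one_lt_cof_iff.2 hlim)).eq_or_lt' with hcof | hcof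
    · rw [hS.F_lim_countable α hα hlim hcof]
      exact ⟨isCompleteNormalFilter_normalOmegaOneFilterGenerated hne,
        subset_normalOmegaOneFilterGenerated _⟩
    · rw [hS.F_lim_uncountable α hα hlim hcof]
      exact ⟨isCompleteNormalFilter_normalFilterGenerated hne
        (fun g _ => conjSubgroup_mem_headPullbacks (fun β hβ => (ih' β hβ).1.toIsNormalFilter) g)
        (hS.iInf_mem_headPullbacks hα hlim hcof ih'), subset_normalFilterGenerated _⟩

end IterationData

/-! ### The action on names -/

namespace ForcingNotion

variable {P : ForcingNotion.{u}}

/-- Induction along the first coordinates of the pairs in a set. -/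
theorem pair_induction {C : ZFSet.{u} → Prop}
    (h : ∀ x, (∀ (y : ZFSet.{u}) (p : P.Cond), ZFSet.pair y p.1 ∈ x → C y) → C x)
    (x : ZFSet.{u}) : C x :=
  h x fun y _ _ => pair_induction h y
termination_by x.rank
decreasing_by exact rank_lt_of_pair_mem (by assumption)

theorem mem_act {π : Equiv.Perm P.Cond} {x z : ZFSet.{u}} :
    z ∈ P.act π x ↔ ∃ (y : ZFSet.{u}) (p : P.Cond), ZFSet.pair y p.1 ∈ x ∧
      z = ZFSet.pair (P.act π y) (π p).1 := by
  rw [act, ZFSet.mem_range]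
  constructor
  · rintro ⟨⟨⟨y, p⟩, h⟩, rfl⟩
    exact ⟨y, p, h, rfl⟩
  · rintro ⟨y, p, h, rfl⟩
    exact ⟨⟨⟨y, p⟩, h⟩, rfl⟩

theorem pair_mem_act {π : Equiv.Perm P.Cond} {x y : ZFSet.{u}} {p : P.Cond}
    (h : ZFSet.pair y p.1 ∈ x) : ZFSet.pair (P.act π y) (π p).1 ∈ P.act π x :=
  mem_act.2 ⟨y, p, h, rfl⟩

theorem exists_of_pair_mem_act {π : Equiv.Perm P.Cond} {x y : ZFSet.{u}} {p : P.Cond}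
    (h : ZFSet.pair y p.1 ∈ P.act π x) :
    ∃ (z : ZFSet.{u}) (q : P.Cond), ZFSet.pair z q.1 ∈ x ∧ y = P.act π z ∧ p = π q := by
  obtain ⟨z, q, hzq, h⟩ := mem_act.1 h
  obtain ⟨h₁, h₂⟩ := ZFSet.pair_injective h
  exact ⟨z, q, hzq, h₁, SetElt.ext h₂⟩

/-- The action maps arbitrary sets to names, since it drops all elements that do not code pairs. -/
theorem isName_act (π : Equiv.Perm P.Cond) (x : ZFSet.{u}) : P.IsName (P.act π x) := by
  induction x using pair_induction (P := P) with
  | h x ih =>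
  refine .mk _ (fun z hz => ?_) fun y p hy => ?_
  · obtain ⟨y, p, -, rfl⟩ := mem_act.1 hz
    exact ⟨_, _, rfl⟩
  · obtain ⟨z, q, hzq, rfl, -⟩ := exists_of_pair_mem_act hy
    exact ih z q hzq

theorem act_mul (π τ : Equiv.Perm P.Cond) (x : ZFSet.{u}) :
    P.act (π * τ) x = P.act π (P.act τ x) := by
  induction x using pair_induction (P := P) with
  | h x ih =>
  ext z
  constructor
  · intro hz
    obtain ⟨y, p, hy, rfl⟩ := mem_act.1 hz
    rw [ih y p hy]
    exact pair_mem_act (pair_mem_act hy)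
  · intro hz
    obtain ⟨y', p', hy', rfl⟩ := mem_act.1 hz
    obtain ⟨y, p, hy, rfl, rfl⟩ := exists_of_pair_mem_act hy'
    rw [← ih y p hy]
    exact pair_mem_act (π := π * τ) hy

theorem IsName.act_one {x : ZFSet.{u}} (hx : P.IsName x) : P.act 1 x = x := by
  induction hx with
  | mk x pairs names ih =>
  ext z
  constructor
  · intro hz
    obtain ⟨y, p, hy, rfl⟩ := mem_act.1 hz
    rw [ih y p hy]
    exact hy
  · intro hz
    obtain ⟨y, p, rfl⟩ := pairs z hz
    exact mem_act.2 ⟨y, p, hz, by rw [ih y p hz]; rfl⟩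

theorem IsName.act_inv_act {x : ZFSet.{u}} (hx : P.IsName x) (π : Equiv.Perm P.Cond) :
    P.act π⁻¹ (P.act π x) = x := by
  rw [← act_mul, inv_mul_cancel, hx.act_one]

theorem IsName.act_act_inv {x : ZFSet.{u}} (hx : P.IsName x) (π : Equiv.Perm P.Cond) :
    P.act π (P.act π⁻¹ x) = x := by
  rw [← act_mul, mul_inv_cancel, hx.act_one]

theorem IsName.of_pair_mem {x y : ZFSet.{u}} {p : P.Cond} (hx : P.IsName x)
    (h : ZFSet.pair y p.1 ∈ x) : P.IsName y := by
  obtain ⟨_, -, names⟩ := hx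
  exact names y p h

theorem IsName.exists_pair {x z : ZFSet.{u}} (hx : P.IsName x) (h : z ∈ x) :
    ∃ (y : ZFSet.{u}) (p : P.Cond), z = ZFSet.pair y p.1 := by
  obtain ⟨_, pairs, -⟩ := hx
  exact pairs z h

theorem IsName.act_inv_eq {x : ZFSet.{u}} (hx : P.IsName x) {π : Equiv.Perm P.Cond}
    (h : P.act π x = x) : P.act π⁻¹ x = x := by
  conv_lhs => rw [← h]
  exact hx.act_inv_act π

theorem IsName.act_eq_of_maps {x : ZFSet.{u}} (hx : P.IsName x) {π : Equiv.Perm P.Cond}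
    (h : ∀ (y : ZFSet.{u}) (p : P.Cond), ZFSet.pair y p.1 ∈ x →
      ZFSet.pair (P.act π y) (π p).1 ∈ x)
    (h_inv : ∀ (y : ZFSet.{u}) (p : P.Cond), ZFSet.pair y p.1 ∈ x →
      ZFSet.pair (P.act π⁻¹ y) (π⁻¹ p).1 ∈ x) : P.act π x = x := by
  ext z
  constructor
  · intro hz
    obtain ⟨y, p, hy, rfl⟩ := mem_act.1 hz
    exact h y p hy
  · intro hz
    obtain ⟨y, p, rfl⟩ := hx.exists_pair hz
    refine mem_act.2 ⟨_, _, h_inv y p hz, ?_⟩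
    rw [(hx.of_pair_mem hz).act_act_inv, show π (π⁻¹ p) = p from π.apply_symm_apply p]

/-! ### Hereditarily symmetric names -/

section HS

variable {G : Subgroup (Equiv.Perm P.Cond)} {F : Set (Subgroup G)}

theorem HS.isName {x : ZFSet.{u}} (hx : P.HS G F x) : P.IsName x := by
  obtain ⟨_, name, -, -⟩ := hx
  exact name

theorem HS.exists_subgroup {x : ZFSet.{u}} (hx : P.HS G F x) :
    ∃ H ∈ F, (H : Set G) = P.sym G x := by
  obtain ⟨_, -, symm, -⟩ := hx
  exact symm

theorem HS.of_pair_mem {x y : ZFSet.{u}} {p : P.Cond} (hx : P.HS G F x)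
    (h : ZFSet.pair y p.1 ∈ x) : P.HS G F y := by
  obtain ⟨_, -, -, hered⟩ := hx
  exact hered y p h

/-- The stabilizer of a name, as a subgroup. -/
def IsName.symSubgroup {x : ZFSet.{u}} (hx : P.IsName x) (G : Subgroup (Equiv.Perm P.Cond)) :
    Subgroup G where
  carrier := P.sym G x
  one_mem' := hx.act_one
  mul_mem' := by
    intro a b ha hb
    change P.act (a.1 * b.1) x = x
    rw [act_mul, show P.act b.1 x = x from hb]
    exact ha
  inv_mem' := fun ha => hx.act_inv_eq ha

theorem HS.of_sym (hF : IsCompleteNormalFilter F) {x : ZFSet.{u}} (hx : P.IsName x)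
    (hdom : ∀ (z : ZFSet.{u}) (p : P.Cond), ZFSet.pair z p.1 ∈ x → P.HS G F z)
    {ι : Type*} [Countable ι] (y : ι → ZFSet.{u}) (hy : ∀ i, P.HS G F (y i))
    (h : ∀ g : G, (∀ i, g ∈ P.sym G (y i)) → g ∈ P.sym G x) : P.HS G F x := by
  choose H hH hHy using fun i => (hy i).exists_subgroup
  refine .mk x hx ⟨hx.symSubgroup G, ?_, rfl⟩ hdom
  refine hF.mono _ _ (hF.iInf_mem H hH) fun g hg => h g fun i => ?_
  rw [← hHy i]
  exact Subgroup.mem_iInf.1 hg i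

/-- It suffices that the group elements fixing the inputs map `x` into itself, because these
elements are closed under inverses. -/
theorem HS.of_maps (hF : IsCompleteNormalFilter F) {x : ZFSet.{u}}
    (hx : ∀ z ∈ x, ∃ (y : ZFSet.{u}) (p : P.Cond), z = ZFSet.pair y p.1)
    (hdom : ∀ (z : ZFSet.{u}) (p : P.Cond), ZFSet.pair z p.1 ∈ x → P.HS G F z)
    {ι : Type*} [Countable ι] (y : ι → ZFSet.{u}) (hy : ∀ i, P.HS G F (y i))
    (h : ∀ g ∈ G, (∀ i, P.act g (y i) = y i) → ∀ (z : ZFSet.{u}) (p : P.Cond),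
      ZFSet.pair z p.1 ∈ x → ZFSet.pair (P.act g z) (g p).1 ∈ x) : P.HS G F x := by
  have hname : P.IsName x := .mk x hx fun z p hz => (hdom z p hz).isName
  exact HS.of_sym hF hname hdom y hy fun g hg => hname.act_eq_of_maps (h g.1 g.2 hg)
    (h _ (G.inv_mem g.2) fun i => (hy i).isName.act_inv_eq (hg i))

end HS

/-! ### Pairs, check names, tuples and unions -/

theorem mem_pairName {x y z : ZFSet.{u}} :
    z ∈ P.pairName x y ↔ z = ZFSet.pair x P.one.1 ∨ z = ZFSet.pair y P.one.1 := by
  simp [pairName]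

theorem pair_mem_pairName {x y z : ZFSet.{u}} {p : P.Cond} :
    ZFSet.pair z p.1 ∈ P.pairName x y ↔ (z = x ∨ z = y) ∧ p = P.one := by
  rw [mem_pairName, ZFSet.pair_inj, ZFSet.pair_inj, SetElt.ext_iff]
  tauto

theorem act_pairName {π : Equiv.Perm P.Cond} (hπ : π P.one = P.one) (x y : ZFSet.{u}) :
    P.act π (P.pairName x y) = P.pairName (P.act π x) (P.act π y) := by
  ext z
  rw [mem_act, mem_pairName]
  constructor
  · rintro ⟨w, p, hw, rfl⟩
    obtain ⟨rfl | rfl, rfl⟩ := pair_mem_pairName.1 hw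
    · exact .inl (by rw [hπ])
    · exact .inr (by rw [hπ])
  · rintro (rfl | rfl)
    · exact ⟨x, P.one, pair_mem_pairName.2 ⟨.inl rfl, rfl⟩, by rw [hπ]⟩
    · exact ⟨y, P.one, pair_mem_pairName.2 ⟨.inr rfl, rfl⟩, by rw [hπ]⟩

theorem act_opName {π : Equiv.Perm P.Cond} (hπ : π P.one = P.one) (x y : ZFSet.{u}) :
    P.act π (P.opName x y) = P.opName (P.act π x) (P.act π y) := by
  simp only [opName, act_pairName hπ]

theorem mem_check {a z : ZFSet.{u}} :
    z ∈ P.check a ↔ ∃ b ∈ a, z = ZFSet.pair (P.check b) P.one.1 := by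
  rw [check, ZFSet.mem_range]
  simp [eq_comm]

theorem act_check {π : Equiv.Perm P.Cond} (hπ : π P.one = P.one) (a : ZFSet.{u}) :
    P.act π (P.check a) = P.check a := by
  induction a using ZFSet.inductionOn with
  | _ a ih =>
  ext z
  rw [mem_act, mem_check]
  constructor
  · rintro ⟨w, p, hw, rfl⟩
    obtain ⟨b, hb, h⟩ := mem_check.1 hw
    obtain ⟨rfl, h'⟩ := ZFSet.pair_injective h
    obtain rfl := SetElt.ext h'
    exact ⟨b, hb, by rw [ih b hb, hπ]⟩
  · rintro ⟨b, hb, rfl⟩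
    exact ⟨P.check b, P.one, mem_check.2 ⟨b, hb, rfl⟩, by rw [ih b hb, hπ]⟩

theorem mem_tupleName {J z : ZFSet.{u}} {x : {j : ZFSet.{u} // j ∈ J} → ZFSet.{u}} :
    z ∈ P.tupleName J x ↔ ∃ j, z = ZFSet.pair (P.opName (P.check j.1) (x j)) P.one.1 := by
  rw [tupleName, ZFSet.mem_range]
  simp only [eq_comm]

section HS

variable {G : Subgroup (Equiv.Perm P.Cond)} {F : Set (Subgroup G)}

theorem HS.pairName (hF : IsCompleteNormalFilter F) (hG : G ≤ P.Aut) {x y : ZFSet.{u}}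
    (hx : P.HS G F x) (hy : P.HS G F y) : P.HS G F (P.pairName x y) := by
  refine HS.of_maps hF ?_ ?_ (fun i : Bool => if i then x else y)
    (by rintro (_ | _) <;> simpa) ?_
  · rintro z hz
    rcases mem_pairName.1 hz with rfl | rfl
    exacts [⟨_, _, rfl⟩, ⟨_, _, rfl⟩]
  · rintro z p hz
    rcases (pair_mem_pairName.1 hz).1 with rfl | rfl <;> assumption
  · intro g hg hfix z p hz
    have h := pair_mem_act (π := g) hz
    rwa [act_pairName (hG hg).2, show P.act g x = x from hfix true,
      show P.act g y = y from hfix false] at h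

theorem HS.opName (hF : IsCompleteNormalFilter F) (hG : G ≤ P.Aut) {x y : ZFSet.{u}}
    (hx : P.HS G F x) (hy : P.HS G F y) : P.HS G F (P.opName x y) :=
  (hx.pairName hF hG hx).pairName hF hG (hx.pairName hF hG hy)

theorem HS.check (hF : IsCompleteNormalFilter F) (hG : G ≤ P.Aut) (a : ZFSet.{u}) :
    P.HS G F (P.check a) := by
  induction a using ZFSet.inductionOn with
  | _ a ih =>
  refine HS.of_maps hF ?_ ?_ (Empty.elim : Empty → ZFSet.{u}) (fun i => i.elim) ?_
  · intro z hz
    obtain ⟨b, -, rfl⟩ := mem_check.1 hz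
    exact ⟨_, _, rfl⟩
  · intro z p hz
    obtain ⟨b, hb, h⟩ := mem_check.1 hz
    obtain ⟨rfl, -⟩ := ZFSet.pair_injective h
    exact ih b hb
  · intro g hg _ z p hz
    have h := pair_mem_act (π := g) hz
    rwa [act_check (hG hg).2] at h

theorem HS.tupleName (hF : IsCompleteNormalFilter F) (hG : G ≤ P.Aut) {J : ZFSet.{u}}
    {x : {j : ZFSet.{u} // j ∈ J} → ZFSet.{u}} (hJ : {j | j ∈ J}.Countable)
    (hx : ∀ j, P.HS G F (x j)) : P.HS G F (P.tupleName J x) := by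
  have : Countable {j : ZFSet.{u} // j ∈ J} := hJ.to_subtype
  refine HS.of_maps hF ?_ ?_ x hx ?_
  · intro z hz
    obtain ⟨j, rfl⟩ := mem_tupleName.1 hz
    exact ⟨_, _, rfl⟩
  · intro z p hz
    obtain ⟨j, h⟩ := mem_tupleName.1 hz
    obtain ⟨rfl, -⟩ := ZFSet.pair_injective h
    exact (HS.check hF hG _).opName hF hG (hx j)
  · intro g hg hfix z p hz
    obtain ⟨j, h⟩ := mem_tupleName.1 hz
    obtain ⟨rfl, h'⟩ := ZFSet.pair_injective h
    obtain rfl := SetElt.ext h'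
    rw [act_opName (hG hg).2, act_check (hG hg).2, hfix j, (hG hg).2]
    exact hz

theorem HS.unionName (hF : IsCompleteNormalFilter F) (hG : G ≤ P.Aut) {A : ZFSet.{u}}
    (hA : P.HS G F A) : P.HS G F (P.unionName A) := by
  refine HS.of_maps hF ?_ ?_ (fun _ : Unit => A) (fun _ => hA) ?_
  · intro z hz
    rw [ForcingNotion.unionName, ZFSet.mem_sep] at hz
    obtain ⟨-, τ, r, rfl, -⟩ := hz
    exact ⟨τ, r, rfl⟩
  · intro τ r hz
    obtain ⟨σ, p, q, hσ, hτ, -, -⟩ := P.pair_mem_unionName.1 hz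
    exact (hA.of_pair_mem hσ).of_pair_mem hτ
  · intro g hg hfix τ r hz
    obtain ⟨σ, p, q, hσ, hτ, hp, hq⟩ := P.pair_mem_unionName.1 hz
    have h := pair_mem_act (π := g) hσ
    rw [hfix ()] at h
    exact P.pair_mem_unionName.2
      ⟨_, _, _, h, pair_mem_act hτ, ((hG hg).1 _ _).1 hp, ((hG hg).1 _ _).1 hq⟩

end HS

/-! ### The symmetry lemma and bounded Separation -/

theorem apply_le_iff {π : Equiv.Perm P.Cond} (hπ : π ∈ P.Aut) {p q : P.Cond} :
    π p ≤ π q ↔ p ≤ q :=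
  (hπ.1 p q).symm

theorem fEq_act_of_fEq {π : Equiv.Perm P.Cond} (hπ : π ∈ P.Aut) {a b : ZFSet.{u}} {p : P.Cond}
    (h : P.fEq a b p) : P.fEq (P.act π a) (P.act π b) (π p) := by
  induction a using pair_induction (P := P) generalizing b p with
  | h a ih =>
  rw [fEq] at h ⊢
  obtain ⟨h₁, h₂⟩ := h
  constructor
  · intro σ' s' hσ' q' hqp hqs
    obtain ⟨σ, s, hσ, rfl, rfl⟩ := exists_of_pair_mem_act hσ'
    obtain ⟨q, rfl⟩ := π.surjective q'
    obtain ⟨r, hr, τ, t, hτ, hrt, he⟩ :=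
      h₁ σ s hσ q ((apply_le_iff hπ).1 hqp) ((apply_le_iff hπ).1 hqs)
    exact ⟨π r, (apply_le_iff hπ).2 hr, _, _, pair_mem_act hτ, (apply_le_iff hπ).2 hrt,
      ih σ s hσ he⟩
  · intro τ' t' hτ' q' hqp hqt
    obtain ⟨τ, t, hτ, rfl, rfl⟩ := exists_of_pair_mem_act hτ'
    obtain ⟨q, rfl⟩ := π.surjective q'
    obtain ⟨r, hr, σ, s, hσ, hrs, he⟩ :=
      h₂ τ t hτ q ((apply_le_iff hπ).1 hqp) ((apply_le_iff hπ).1 hqt)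
    exact ⟨π r, (apply_le_iff hπ).2 hr, _, _, pair_mem_act hσ, (apply_le_iff hπ).2 hrs,
      ih σ s hσ he⟩

theorem fMem_act_of_fMem {π : Equiv.Perm P.Cond} (hπ : π ∈ P.Aut) {a b : ZFSet.{u}} {p : P.Cond}
    (h : fMem a b p) : fMem (P.act π a) (P.act π b) (π p) := by
  intro q' hq
  obtain ⟨q, rfl⟩ := π.surjective q'
  obtain ⟨r, hr, τ, t, hτ, hrt, he⟩ := h q ((apply_le_iff hπ).1 hq)
  exact ⟨π r, (apply_le_iff hπ).2 hr, _, _, pair_mem_act hτ, (apply_le_iff hπ).2 hrt,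
    fEq_act_of_fEq hπ he⟩

theorem fEq_act {π : Equiv.Perm P.Cond} (hπ : π ∈ P.Aut) {a b : ZFSet.{u}} (ha : P.IsName a)
    (hb : P.IsName b) {p : P.Cond} :
    P.fEq (P.act π a) (P.act π b) (π p) ↔ P.fEq a b p := by
  refine ⟨fun h => ?_, fEq_act_of_fEq hπ⟩
  simpa [ha.act_inv_act, hb.act_inv_act] using fEq_act_of_fEq (P.Aut.inv_mem hπ) h

theorem fMem_act {π : Equiv.Perm P.Cond} (hπ : π ∈ P.Aut) {a b : ZFSet.{u}} (ha : P.IsName a)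
    (hb : P.IsName b) {p : P.Cond} :
    fMem (P.act π a) (P.act π b) (π p) ↔ fMem a b p := by
  refine ⟨fun h => ?_, fMem_act_of_fMem hπ⟩
  simpa [ha.act_inv_act, hb.act_inv_act] using fMem_act_of_fMem (P.Aut.inv_mem hπ) h

theorem fNot_apply {π : Equiv.Perm P.Cond} (hπ : π ∈ P.Aut) {φ φ' : P.Cond → Prop}
    (h : ∀ p, φ' (π p) ↔ φ p) (p : P.Cond) : fNot φ' (π p) ↔ fNot φ p := by
  constructor
  · intro H q hq hφ
    exact H (π q) ((apply_le_iff hπ).2 hq) ((h q).2 hφ)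
  · intro H q' hq hφ
    obtain ⟨q, rfl⟩ := π.surjective q'
    exact H q ((apply_le_iff hπ).1 hq) ((h q).1 hφ)

theorem fAll_apply {π : Equiv.Perm P.Cond} {φ φ' : ZFSet.{u} → P.Cond → Prop}
    (h : ∀ x, P.IsName x → ∀ p, φ' (P.act π x) (π p) ↔ φ x p) (p : P.Cond) :
    fAll φ' (π p) ↔ fAll φ p := by
  constructor
  · intro H x hx
    exact (h x hx p).1 (H _ (isName_act π x))
  · intro H x hx
    rw [← hx.act_act_inv π]
    exact (h _ (isName_act _ _) p).2 (H _ (isName_act _ _))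

/-- The symmetry lemma for bounded formulas. -/
theorem forces_act {π : Equiv.Perm P.Cond} (hπ : π ∈ P.Aut) {n : ℕ} (φ : Delta0Formula n)
    (v : Fin n → ZFSet.{u}) (hv : ∀ i, P.IsName (v i)) (p : P.Cond) :
    forces φ (fun i => P.act π (v i)) (π p) ↔ forces φ v p := by
  induction φ generalizing p with
  | mem i j => exact fMem_act hπ (hv i) (hv j)
  | eq i j => exact fEq_act hπ (hv i) (hv j)
  | neg φ ih => exact fNot_apply hπ (ih v hv) p
  | and φ ψ ih₁ ih₂ => exact and_congr (ih₁ v hv p) (ih₂ v hv p)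
  | ball i φ ih =>
    refine fAll_apply (fun x hx => fNot_apply hπ fun q =>
      and_congr (fMem_act hπ hx (hv i)) (fNot_apply hπ (fun r => ?_) q)) p
    refine Iff.trans ?_ (ih (Fin.cons x v) (Fin.cases hx hv) r)
    refine iff_of_eq (congrArg (fun w => forces φ w (π r)) (funext fun j => ?_))
    cases j using Fin.cases <;> rfl

theorem HS.sepName {G : Subgroup (Equiv.Perm P.Cond)} {F : Set (Subgroup G)}
    (hF : IsCompleteNormalFilter F) (hG : G ≤ P.Aut) {n : ℕ} (φ : Delta0Formula (n + 1))
    {A : ZFSet.{u}} {v : Fin n → ZFSet.{u}} (hA : P.HS G F A) (hv : ∀ i, P.HS G F (v i)) :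
    P.HS G F (P.sepName φ A v) := by
  refine HS.of_maps hF ?_ ?_ (fun i : Option (Fin n) => i.elim A v)
    (by rintro (_ | i); exacts [hA, hv i]) ?_
  · intro z hz
    rw [ForcingNotion.sepName, ZFSet.mem_sep] at hz
    obtain ⟨-, σ, q, rfl, -⟩ := hz
    exact ⟨σ, q, rfl⟩
  · intro σ q hz
    obtain ⟨⟨p, hp, -⟩, -⟩ := P.pair_mem_sepName.1 hz
    exact hA.of_pair_mem hp
  · intro g hg hfix σ q hz
    obtain ⟨⟨p, hp, hqp⟩, hφ⟩ := P.pair_mem_sepName.1 hz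
    have hσ := (hA.of_pair_mem hp).isName
    have hgp := pair_mem_act (π := g) hp
    rw [show P.act g A = A from hfix none] at hgp
    refine P.pair_mem_sepName.2 ⟨⟨g p, hgp, ((hG hg).1 _ _).1 hqp⟩, ?_⟩
    rw [← forces_act (hG hg) φ _ (Fin.cases hσ fun i => (hv i).isName)] at hφ
    convert hφ using 1
    funext j
    cases j using Fin.cases with
    | zero => rfl
    | succ i => exact (hfix (some i)).symm

end ForcingNotion

theorem mainTheorem6 (Θ : Ordinal.{u}) (S : IterationData.{u}) (hS : S.IsCSIteration Θ)
    (lam : Ordinal.{u}) (hlam : lam ≤ Θ) :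
    -- pairing: unordered and ordered pairs
    (∀ x y, S.HSAt lam x → S.HSAt lam y →
      S.HSAt lam ((S.P lam).pairName x y) ∧ S.HSAt lam ((S.P lam).opName x y)) ∧
    -- countable tuples
    (∀ (J : ZFSet.{u}) (x : {j : ZFSet.{u} // j ∈ J} → ZFSet.{u}), {j | j ∈ J}.Countable →
      (∀ j, S.HSAt lam (x j)) → S.HSAt lam ((S.P lam).tupleName J x)) ∧
    -- unions
    (∀ A, S.HSAt lam A → S.HSAt lam ((S.P lam).unionName A)) ∧
    -- bounded Separation
    (∀ (n : ℕ) (φ : Delta0Formula (n + 1)) (A : ZFSet.{u}) (v : Fin n → ZFSet.{u}),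
      S.HSAt lam A → (∀ i, S.HSAt lam (v i)) → S.HSAt lam ((S.P lam).sepName φ A v)) ∧
    -- check names
    (∀ a, S.HSAt lam ((S.P lam).check a)) ∧
    -- any other constructor that is determined by countably many hereditarily symmetric names
    (∀ (x : ZFSet.{u}) (y : ℕ → ZFSet.{u}), (S.P lam).IsName x → (∀ n, S.HSAt lam (y n)) →
      (∀ z ∈ (S.P lam).dom x, S.HSAt lam z) →
      (∀ g : S.G lam, (∀ n, g ∈ (S.P lam).sym (S.G lam) (y n)) → g ∈ (S.P lam).sym (S.G lam) x) →
      S.HSAt lam x) := by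
  have hF := (hS.filter_properties lam hlam).1
  have hG := hS.G_le lam hlam
  refine ⟨fun x y hx hy => ⟨hx.pairName hF hG hy, hx.opName hF hG hy⟩,
    fun J x hJ hx => ForcingNotion.HS.tupleName hF hG hJ hx,
    fun A hA => hA.unionName hF hG,
    fun n φ A v hA hv => ForcingNotion.HS.sepName hF hG φ hA hv,
    ForcingNotion.HS.check hF hG, fun x y hx hy hdom h => ?_⟩
  exact ForcingNotion.HS.of_sym hF hx
    (fun z p hz => hdom z ((S.P lam).mem_dom.2 ⟨p, hz⟩)) y hy h
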